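/- Let $\mathcal B$ be a braided monoidal category with unit object $\mathbb 1$ and braiding $\tau$ (associativity and unitality constraints are suppressed), and let $H=(H,m,u,\Delta,\varepsilon,S)$ be a Hopf algebra in $\mathcal B$ with invertible antipode $S$. Write elementwise $\Delta(h)=h_1\otimes h_2$, $(\Delta\otimes\mathrm{id})\Delta(h)=h_1\otimes h_2\otimes h_3$. A modular pair for $H$ is a pair $(\delta,\sigma)$ of an algebra morphism $\delta\colon H\to\mathbb 1$ and a coalgebra morphism $\sigma\colon\mathbb 1\to H$ with $\delta\sigma=\mathrm{id}_{\mathbb 1}$; in particular $(\varepsilon,u)$ is a modular pair. The following structures on $H^{\otimes n}$ are used. * The left diagonal action $\lambda_n\colon H\otimes H^{\otimes n}\to H^{\otimes n}$: $\lambda_0=\varepsilon$, and for $n\ge 1$, $\lambda_n=(m\otimes\lambda_{n-1})(\mathrm{id}_H\otimes\tau_{H,H}\otimes\mathrm{id}_{H^{\otimes n-1}})(\Delta\otimes\mathrm{id}_{H^{\otimes n}})$. * The right adjoint action $\mathrm{ad}_n\colon H^{\otimes n}\otimes H\to H^{\otimes n}$: $\mathrm{ad}_0=\varepsilon$, and for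 $n\ge1$, $\mathrm{ad}_n=(\mathrm{ad}_{n-1}\otimes \mathrm{ad})(\mathrm{id}_{H^{\otimes n-1}}\otimes\tau_{H,H}\otimes\mathrm{id}_H)(\mathrm{id}_{H^{\otimes n}}\otimes\Delta)$, where $\mathrm{ad}=m(m\otimes\mathrm{id}_H)(\tau_{H,H}\otimes\mathrm{id}_H)(\mathrm{id}_H\otimes S\otimes\mathrm{id}_H)(\mathrm{id}_H\otimes\Delta)\colon H\otimes H\to H$ (in the category of vector spaces, $h\otimes a\mapsto S(a_1)ha_2$). * The left coadjoint coaction $\mathrm{coad}_n\colon H^{\otimes n}\to H\otimes H^{\otimes n}$: $\mathrm{coad}_0=u$, and for $n\ge1$, $\mathrm{coad}_n=(m\otimes\mathrm{id}_{H^{\otimes n}})(\mathrm{id}_H\otimes\tau_{H,H}\otimes\mathrm{id}_{H^{\otimes n-1}})(\mathrm{coad}\otimes\mathrm{coad}_{n-1})$, where $\mathrm{coad}=(m\otimes\mathrm{id}_H)(\mathrm{id}_H\otimes\tau_{H,H})(\mathrm{id}_H\otimes\mathrm{id}_H\otimes S)(\mathrm{id}_H\otimes\Delta)\Delta\colon H\to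 H\otimes H$ (in the category of vector spaces, $h\mapsto h_1S(h_3)\otimes h_2$). For a modular pair $(\delta,\sigma)$, the paracocyclic operators $\tau_n(\delta,\sigma)\colon H^{\otimes n}\to H^{\otimes n}$ are $\tau_0(\delta,\sigma)=\mathrm{id}_{\mathbb 1}$ and, for $n\ge1$, $$\tau_n(\delta,\sigma)=\lambda_n(\tilde S\otimes\mathrm{id}_{H^{\otimes n-1}}\otimes\sigma),\qquad \tilde S=(\delta\otimes S)\Delta .$$ Then for any modular pair $(\delta,\sigma)$ for $H$ and any $n\in\mathbb N=\{0,1,2,\dots\}$, $$(\tau_n(\delta,\sigma))^{n+1}=\mathrm{ad}_n(\mathrm{id}_{H^{\otimes n}}\otimes\sigma)\,\circ\,(\tau_n(\varepsilon,u))^{n+1}\,\circ\,(\delta\otimes\mathrm{id}_{H^{\otimes n}})\,\mathrm{coad}_n .$$ -/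

import Mathlib

open CategoryTheory MonoidalCategory
open scoped MonObj ComonObj HopfObj

namespace BraidedConnesMoscovici

universe v u

section

variable {C : Type u} [Category.{v} C] [MonoidalCategory C]

/-- The tensor power `X^{⊗n}`, with `X^{⊗0} = 𝟙` and `X^{⊗(n+1)} = X ⊗ X^{⊗n}`. -/
def tensorPow (X : C) : ℕ → C
  | 0 => 𝟙_ C
  | n + 1 => X ⊗ tensorPow X n

/-- The isomorphism `X^{⊗n} ⊗ X ≅ X^{⊗(n+1)}` made of associativity and unitality constraints
only: it splits off the last tensorand instead of the first. -/
def tensorPowSnoc (X : C) : (n : ℕ) → (tensorPow X n ⊗ X ≅ tensorPow X (n + 1))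
  | 0 => (λ_ X) ≪≫ (ρ_ X).symm
  | n + 1 => (α_ X (tensorPow X n) X) ≪≫ whiskerLeftIso X (tensorPowSnoc X n)

variable [BraidedCategory C]

/-- The left action on `M ⊗ N` built from left actions on `M` and `N`:
`(r ⊗ r') (id ⊗ τ_{H,M} ⊗ id) (Δ ⊗ id ⊗ id)`. -/
def tensorLeftAction {H M N : C} [ComonObj H] (r : H ⊗ M ⟶ M) (r' : H ⊗ N ⟶ N) :
    H ⊗ (M ⊗ N) ⟶ M ⊗ N :=
  Δ[H] ▷ (M ⊗ N) ≫ tensorμ H H M N ≫ (r ⊗ₘ r')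

/-- The right action on `M ⊗ N` built from right actions on `M` and `N`:
`(r ⊗ r') (id ⊗ τ_{N,H} ⊗ id) (id ⊗ id ⊗ Δ)`. -/
def tensorRightAction {H M N : C} [ComonObj H] (r : M ⊗ H ⟶ M) (r' : N ⊗ H ⟶ N) :
    (M ⊗ N) ⊗ H ⟶ M ⊗ N :=
  (M ⊗ N) ◁ Δ[H] ≫ tensorμ M N H H ≫ (r ⊗ₘ r')

/-- The left coaction on `M ⊗ N` built from left coactions on `M` and `N`:
`(m ⊗ id ⊗ id) (id ⊗ τ_{M,H} ⊗ id) (c ⊗ c')`. -/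
def tensorLeftCoaction {H M N : C} [MonObj H] (c : M ⟶ H ⊗ M) (c' : N ⟶ H ⊗ N) :
    M ⊗ N ⟶ H ⊗ (M ⊗ N) :=
  (c ⊗ₘ c') ≫ tensorμ H M H N ≫ μ[H] ▷ (M ⊗ N)

/-- The left diagonal action `H ⊗ H^{⊗n} ⟶ H^{⊗n}`: the counit for `n = 0`; for `n + 1`, the
tensor product of left multiplication on `H` and of the left diagonal action on `H^{⊗n}`. -/
def leftDiag (H : C) [BimonObj H] : (n : ℕ) → (H ⊗ tensorPow H n ⟶ tensorPow H n)
  | 0 => (ρ_ H).hom ≫ ε[H]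
  | n + 1 => tensorLeftAction μ[H] (leftDiag H n)

/-- The right adjoint action of `H` on itself, `h ⊗ a ↦ S(a₁) h a₂`, where `a₁` crosses `h`
through the braiding `τ_{H,H}`. -/
def rightAdSelf (H : C) [HopfObj H] : H ⊗ H ⟶ H :=
  H ◁ Δ[H] ≫ H ◁ (𝒮[H] ▷ H) ≫ (α_ H H H).inv ≫ (β_ H H).hom ▷ H ≫ μ[H] ▷ H ≫ μ[H]

/-- The right adjoint action `H^{⊗n} ⊗ H ⟶ H^{⊗n}`: the counit for `n = 0`; on
`H^{⊗(n+1)} = H^{⊗n} ⊗ H`, the tensor product of the right adjoint actions on `H^{⊗n}`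
and on `H`. -/
def rightAd (H : C) [HopfObj H] : (n : ℕ) → (tensorPow H n ⊗ H ⟶ tensorPow H n)
  | 0 => (λ_ H).hom ≫ ε[H]
  | n + 1 =>
      (tensorPowSnoc H n).inv ▷ H ≫ tensorRightAction (rightAd H n) (rightAdSelf H) ≫
        (tensorPowSnoc H n).hom

/-- The left coadjoint coaction of `H` on itself, `h ↦ h₁ S(h₃) ⊗ h₂`, where `h₂` crosses
`S(h₃)` through the braiding `τ_{H,H}`. -/
def leftCoadSelf (H : C) [HopfObj H] : H ⟶ H ⊗ H :=
  Δ[H] ≫ H ◁ Δ[H] ≫ H ◁ (H ◁ 𝒮[H]) ≫ H ◁ (β_ H H).hom ≫ (α_ H H H).inv ≫ μ[H] ▷ H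

/-- The left coadjoint coaction `H^{⊗n} ⟶ H ⊗ H^{⊗n}`: the unit for `n = 0`; for `n + 1`, the
tensor product of the left coadjoint coactions on `H` and on `H^{⊗n}`. -/
def leftCoad (H : C) [HopfObj H] : (n : ℕ) → (tensorPow H n ⟶ H ⊗ tensorPow H n)
  | 0 => η[H] ≫ (ρ_ H).inv
  | n + 1 => tensorLeftCoaction (leftCoadSelf H) (leftCoad H n)

attribute [local instance] ComonObj.instTensorUnit in
/-- Modular pairs `(δ, σ)` for `H`: an algebra morphism `δ : H ⟶ 𝟙` and a coalgebra morphism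
`σ : 𝟙 ⟶ H` (for the trivial algebra and coalgebra structures on `𝟙`) with `δ σ = id`. -/
structure IsModularPair {H : C} [BimonObj H] (δ : H ⟶ 𝟙_ C) (σ : 𝟙_ C ⟶ H) : Prop where
  isMonHom : IsMonHom δ
  isComonHom : IsComonHom σ
  comp_eq : σ ≫ δ = 𝟙 (𝟙_ C)

/-- The twisted antipode `S̃ = (δ ⊗ S) Δ`. -/
def twistedAntipode {H : C} [HopfObj H] (δ : H ⟶ 𝟙_ C) : H ⟶ H :=
  Δ[H] ≫ (δ ⊗ₘ 𝒮[H]) ≫ (λ_ H).hom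

/-- The paracocyclic operator `τ_n(δ, σ)`: `τ_0(δ, σ) = id`, and for `n ≥ 1` it is
`h₁ ⊗ ⋯ ⊗ h_n ↦ S̃(h₁) · (h₂ ⊗ ⋯ ⊗ h_n ⊗ σ)`, with `·` the left diagonal action. -/
def paracocyclicOp {H : C} [HopfObj H] (δ : H ⟶ 𝟙_ C) (σ : 𝟙_ C ⟶ H) :
    (n : ℕ) → End (tensorPow H n)
  | 0 => 𝟙 (𝟙_ C)
  | n + 1 =>
      (twistedAntipode δ ⊗ₘ
        ((ρ_ (tensorPow H n)).inv ≫ tensorPow H n ◁ σ ≫ (tensorPowSnoc H n).hom)) ≫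
        leftDiag H (n + 1)

/-- The endomorphism of `H^{⊗n}` obtained from the left coadjoint coaction by evaluating the
coacting tensorand with `δ`. -/
def coadBy {H : C} [HopfObj H] (δ : H ⟶ 𝟙_ C) (n : ℕ) : tensorPow H n ⟶ tensorPow H n :=
  leftCoad H n ≫ δ ▷ tensorPow H n ≫ (λ_ (tensorPow H n)).hom

/-- The endomorphism of `H^{⊗n}` obtained from the right adjoint action by inserting `σ` as the
acting tensorand. -/
def adBy {H : C} [HopfObj H] (σ : 𝟙_ C ⟶ H) (n : ℕ) : tensorPow H n ⟶ tensorPow H n :=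
  (ρ_ (tensorPow H n)).inv ≫ tensorPow H n ◁ σ ≫ rightAd H n

end

end BraidedConnesMoscovici

/-! For `n ≥ 1`, write `t` for the operator of the trivial pair. By `paracocyclicOp_eq`, the
operator of `(δ, σ)` is `t` preceded by `h ↦ δ(h₁) h₂` on the first tensorand and followed by `h ↦ h
σ` on the last. Taking its `(n + 1)`-st power amounts to moving all these twists past powers of `t`.

The input twist is the first of a chain `d 0, …, d n` with `d i * t = t * d (i + 1)`: for `i > 0`,
`d i` pairs `h ↦ h₁ δ(S h₂)` on one tensorand with `h ↦ δ(h₁) h₂` on the next, and the two cancel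
inside the diagonal action. The output twist is the last of a chain `g 0, …, g n` with `t * g (i +
1) = g i * t`: right multiplications by `σ` commute with the diagonal action, and on the first
tensorand `S(h σ) = S(σ) S(h)` turns one into diagonal left multiplication by `S(σ)`, which is `g
0`.

A computation in a monoid then collects the `d i` on the right of `t ^ (n + 1)` and the `g i` on its
left. Their products act tensorandwise, by `h ↦ δ(h₁) h₂ δ(S h₃)` and `h ↦ S(σ) h σ`: these are
`coadBy` and `adBy`. -/

namespace BraidedConnesMoscovici

universe v u

/-! ### Powers of a product in a monoid with shifting relations -/

section Monoid

variable {M : Type*} [Monoid M]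

/-- The descending product `f (k - 1) * ⋯ * f 1 * f 0`. -/
def descProd (f : ℕ → M) : ℕ → M
  | 0 => 1
  | k + 1 => f k * descProd f k

theorem descProd_succ' (f : ℕ → M) (n : ℕ) :
    descProd f (n + 1) = descProd (fun i => f (i + 1)) n * f 0 := by
  induction n with
  | zero => simp [descProd]
  | succ n ih => rw [descProd, ih, descProd, mul_assoc]

/-- A factor `f 0` becomes `f k` on moving right past `t ^ k`. -/
theorem mul_pow_of_intertwine_right {t : M} {f : ℕ → M} {n : ℕ}
    (h : ∀ i < n, f i * t = t * f (i + 1)) (k : ℕ) (hk : k ≤ n + 1) :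
    (t * f 0) ^ k = t ^ k * descProd f k := by
  have aux : ∀ k ≤ n, f 0 * t ^ k = t ^ k * f k := by
    intro k
    induction k with
    | zero => simp
    | succ k ih =>
      intro hk
      rw [pow_succ, ← mul_assoc, ih (by omega), mul_assoc, h k (by omega), ← mul_assoc]
  induction k with
  | zero => simp [descProd]
  | succ k ih =>
    rw [pow_succ', ih (by omega), descProd, mul_assoc, ← mul_assoc (f 0), aux k (by omega),
      pow_succ']
    simp only [mul_assoc]

theorem mul_pow_of_intertwine_left {t : M} {f : ℕ → M} {n : ℕ}
    (h : ∀ i < n, t * f (i + 1) = f i * t) :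
    (f n * t) ^ (n + 1) = descProd f (n + 1) * t ^ (n + 1) := by
  have aux : ∀ k ≤ n, t ^ k * f n = f (n - k) * t ^ k := by
    intro k
    induction k with
    | zero => simp
    | succ k ih =>
      intro hk
      rw [pow_succ', mul_assoc, ih (by omega), ← mul_assoc,
        show n - k = n - (k + 1) + 1 by omega, h _ (by omega), mul_assoc]
  -- Here `q` is the partial product of the `k` factors from `f n` downwards, specified by what
  -- completes it to the full product.
  have key : ∀ k ≤ n + 1, ∃ q : M, (f n * t) ^ k = q * t ^ k ∧
      q * descProd f (n + 1 - k) = descProd f (n + 1) := by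
    intro k
    induction k with
    | zero => exact fun _ => ⟨1, by simp, by simp⟩
    | succ k ih =>
      intro hk
      obtain ⟨q, hq, hq'⟩ := ih (by omega)
      refine ⟨q * f (n - k), ?_, ?_⟩
      · rw [pow_succ, hq, mul_assoc, ← mul_assoc (t ^ k), aux k (by omega), pow_succ]
        simp only [mul_assoc]
      · rw [← hq', show n + 1 - k = n - k + 1 by omega, descProd,
          show n + 1 - (k + 1) = n - k by omega, mul_assoc]
  obtain ⟨q, hq, hq'⟩ := key (n + 1) le_rfl
  rw [hq, ← hq', Nat.sub_self, descProd, mul_one]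

end Monoid

variable {C : Type u} [Category.{v} C] [MonoidalCategory C]

/-! ### Endomorphisms of tensor powers acting on chosen tensorands -/

section TensorPow

variable {X : C}

/-- The endomorphism of `X^{⊗n}` acting by `f` on the tensorand of index `i`; it is the identity
when `n ≤ i`. -/
def tensorPowAt (f : X ⟶ X) : (n i : ℕ) → (tensorPow X n ⟶ tensorPow X n)
  | 0, _ => 𝟙 (𝟙_ C)
  | n + 1, 0 => f ▷ tensorPow X n
  | n + 1, i + 1 => X ◁ tensorPowAt f n i

/-- The tensor power `f^{⊗n}`. -/
def tensorPowMap (f : X ⟶ X) : (n : ℕ) → (tensorPow X n ⟶ tensorPow X n)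
  | 0 => 𝟙 (𝟙_ C)
  | n + 1 => f ⊗ₘ tensorPowMap f n

/-- The morphism `X^{⊗n} ⟶ X^{⊗(n+1)}` inserting `σ` as the last tensorand. -/
def tensorPowInsert (σ : 𝟙_ C ⟶ X) (n : ℕ) : tensorPow X n ⟶ tensorPow X (n + 1) :=
  (ρ_ (tensorPow X n)).inv ≫ tensorPow X n ◁ σ ≫ (tensorPowSnoc X n).hom

theorem tensorPowInsert_zero (σ : 𝟙_ C ⟶ X) :
    tensorPowInsert σ 0 = σ ≫ (ρ_ X).inv := by
  change (ρ_ (𝟙_ C)).inv ≫ 𝟙_ C ◁ σ ≫ (λ_ X).hom ≫ (ρ_ X).inv = _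
  rw [leftUnitor_naturality_assoc, ← unitors_inv_equal, Iso.inv_hom_id_assoc]

theorem tensorPowInsert_succ (σ : 𝟙_ C ⟶ X) (n : ℕ) :
    tensorPowInsert σ (n + 1) = X ◁ tensorPowInsert σ n := by
  change (ρ_ (X ⊗ tensorPow X n)).inv ≫ (X ⊗ tensorPow X n) ◁ σ ≫
    (α_ X (tensorPow X n) X).hom ≫ X ◁ (tensorPowSnoc X n).hom = _
  simp [tensorPowInsert]

theorem tensorPowInsert_comp_at (σ τ : 𝟙_ C ⟶ X) (f : X ⟶ X) (h : σ ≫ f = τ) (n : ℕ) :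
    tensorPowInsert σ n ≫ tensorPowAt f (n + 1) n = tensorPowInsert τ n := by
  induction n with
  | zero =>
    rw [tensorPowInsert_zero, tensorPowInsert_zero, ← h]
    change (σ ≫ (ρ_ X).inv) ≫ f ▷ 𝟙_ C = _
    rw [Category.assoc, Category.assoc, rightUnitor_inv_naturality]
  | succ n ih =>
    rw [tensorPowInsert_succ, tensorPowInsert_succ, ← ih]
    exact (whiskerLeft_comp _ _ _).symm

theorem at_comp_tensorPowInsert (σ : 𝟙_ C ⟶ X) (f : X ⟶ X) (n i : ℕ) (hi : i < n) :
    tensorPowAt f n i ≫ tensorPowInsert σ n = tensorPowInsert σ n ≫ tensorPowAt f (n + 1) i := by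
  induction n generalizing i with
  | zero => omega
  | succ n ih =>
    rw [tensorPowInsert_succ]
    cases i with
    | zero => exact (whisker_exchange _ _).symm
    | succ i =>
      change X ◁ tensorPowAt f n i ≫ X ◁ tensorPowInsert σ n =
        X ◁ tensorPowInsert σ n ≫ X ◁ tensorPowAt f (n + 1) i
      rw [← whiskerLeft_comp, ih i (by omega), whiskerLeft_comp]

/-- Inserting a fixed point of `f` commutes with `f` acting on any tensorand, the inserted one
included. -/
theorem at_comp_tensorPowInsert_of_fixed (σ : 𝟙_ C ⟶ X) (f : X ⟶ X) (h : σ ≫ f = σ) (n i : ℕ)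
    (hi : i ≤ n) :
    tensorPowAt f n i ≫ tensorPowInsert σ n = tensorPowInsert σ n ≫ tensorPowAt f (n + 1) i := by
  rcases hi.lt_or_eq with hi | rfl
  · exact at_comp_tensorPowInsert σ f n i hi
  -- The index `n` is out of range before the insertion; after it, `f` meets the inserted fixed
  -- point.
  · have hid : ∀ n, tensorPowAt f n n = 𝟙 _ := by
      intro n
      induction n with
      | zero => rfl
      | succ n ih => rw [tensorPowAt, ih]; exact whiskerLeft_id _ _
    rw [tensorPowInsert_comp_at σ σ f h, hid, Category.id_comp]

theorem tensorPowAt_comm {f g : X ⟶ X} (h : f ≫ g = g ≫ f) (n i j : ℕ) :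
    tensorPowAt f n i ≫ tensorPowAt g n j = tensorPowAt g n j ≫ tensorPowAt f n i := by
  induction n generalizing i j with
  | zero => rfl
  | succ n ih =>
    cases i with
    | zero =>
      cases j with
      | zero =>
        change f ▷ tensorPow X n ≫ g ▷ tensorPow X n = g ▷ tensorPow X n ≫ f ▷ tensorPow X n
        rw [← comp_whiskerRight, h, comp_whiskerRight]
      | succ j => exact (whisker_exchange _ _).symm
    | succ i =>
      cases j with
      | zero => exact whisker_exchange _ _
      | succ j =>
        change X ◁ tensorPowAt f n i ≫ X ◁ tensorPowAt g n j =
          X ◁ tensorPowAt g n j ≫ X ◁ tensorPowAt f n i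
        rw [← whiskerLeft_comp, ih, whiskerLeft_comp]

theorem tensorPowMap_comp (f g : X ⟶ X) (n : ℕ) :
    tensorPowMap (f ≫ g) n = tensorPowMap f n ≫ tensorPowMap g n := by
  induction n with
  | zero => exact (Category.id_comp _).symm
  | succ n ih =>
    rw [tensorPowMap, ih]
    exact (tensorHom_comp_tensorHom _ _ _ _).symm

theorem tensorPowSnoc_naturality (f : X ⟶ X) (n : ℕ) :
    (tensorPowMap f n ⊗ₘ f) ≫ (tensorPowSnoc X n).hom =
      (tensorPowSnoc X n).hom ≫ tensorPowMap f (n + 1) := by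
  induction n with
  | zero =>
    change (𝟙 (𝟙_ C) ⊗ₘ f) ≫ (λ_ X).hom ≫ (ρ_ X).inv =
      ((λ_ X).hom ≫ (ρ_ X).inv) ≫ (f ⊗ₘ 𝟙 (𝟙_ C))
    simp
  | succ n ih =>
    change ((f ⊗ₘ tensorPowMap f n) ⊗ₘ f) ≫
        (α_ X (tensorPow X n) X).hom ≫ X ◁ (tensorPowSnoc X n).hom =
      ((α_ X (tensorPow X n) X).hom ≫ X ◁ (tensorPowSnoc X n).hom) ≫
        (f ⊗ₘ tensorPowMap f (n + 1))
    rw [associator_naturality_assoc, ← id_tensorHom, tensorHom_comp_tensorHom, ih,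
      Category.assoc, tensorHom_comp_tensorHom, Category.comp_id, Category.id_comp]

theorem descProd_whiskerLeft {Y : C} (f : ℕ → End Y) (n : ℕ) :
    descProd (M := End (X ⊗ Y)) (fun i => X ◁ (f i).asHom) n = X ◁ (descProd f n).asHom := by
  induction n with
  | zero => exact (whiskerLeft_id _ _).symm
  | succ n ih =>
    rw [descProd, ih]
    exact (whiskerLeft_comp _ _ _).symm

theorem descProd_tensorPowAt (f : X ⟶ X) (n : ℕ) :
    descProd (M := End (tensorPow X n)) (fun i => tensorPowAt f n i) n = tensorPowMap f n := by
  induction n with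
  | zero => rfl
  | succ n ih =>
    rw [descProd_succ']
    refine Eq.trans ?_ (tensorHom_def f (tensorPowMap f n)).symm
    rw [← ih]
    exact congrArg (f ▷ tensorPow X n ≫ ·) (descProd_whiskerLeft _ _)

/-- `f` acting on the tensorand of index `i` after `g` acting on the preceding one, which is absent
for `i = 0`. -/
def tensorPowStraddle (g f : X ⟶ X) (n : ℕ) : ℕ → (tensorPow X n ⟶ tensorPow X n)
  | 0 => tensorPowAt f n 0
  | i + 1 => tensorPowAt g n i ≫ tensorPowAt f n (i + 1)

/-- Each tensorand gets `f` from one factor and `g` from the next. For `n > 0`, the factor of index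
`n` has its `f` out of range and supplies the last `g`. -/
theorem descProd_tensorPowStraddle (g f : X ⟶ X) (n : ℕ) :
    descProd (M := End (tensorPow X n)) (fun i => tensorPowStraddle g f n i) (n + 1) =
      tensorPowMap (f ≫ g) n := by
  induction n with
  | zero => exact Category.id_comp _
  | succ n ih =>
    rw [descProd_succ', descProd_succ']
    have h : (fun i => tensorPowStraddle g f (n + 1) (i + 1 + 1)) =
        fun i => X ◁ tensorPowStraddle g f n (i + 1) :=
      funext fun i => (whiskerLeft_comp _ _ _).symm
    rw [descProd_succ'] at ih
    refine Eq.trans ?_ (tensorHom_def (f ≫ g) (tensorPowMap (f ≫ g) n)).symm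
    rw [← ih]
    refine Eq.trans (congrArg (fun k => f ▷ tensorPow X n ≫
      (g ▷ tensorPow X n ≫ X ◁ tensorPowAt f n 0) ≫ descProd (M := End (X ⊗ tensorPow X n)) k n) h)
      ?_
    refine Eq.trans (congrArg (fun k => f ▷ tensorPow X n ≫
      (g ▷ tensorPow X n ≫ X ◁ tensorPowAt f n 0) ≫ k) (descProd_whiskerLeft _ n)) ?_
    rw [comp_whiskerRight, Category.assoc, Category.assoc, ← whiskerLeft_comp]
    rfl

end TensorPow

/-! ### Twists by functionals and multiplications by points -/

section Comon

variable {H : C} [ComonObj H]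

/-- The endomorphism `h ↦ χ(h₁) h₂`. -/
def leftHit (χ : H ⟶ 𝟙_ C) : H ⟶ H := Δ[H] ≫ χ ▷ H ≫ (λ_ H).hom

/-- The endomorphism `h ↦ h₁ χ(h₂)`. -/
def rightHit (χ : H ⟶ 𝟙_ C) : H ⟶ H := Δ[H] ≫ H ◁ χ ≫ (ρ_ H).hom

theorem leftHit_comul (χ : H ⟶ 𝟙_ C) : leftHit χ ≫ Δ[H] = Δ[H] ≫ leftHit χ ▷ H := by
  simp only [leftHit, Category.assoc, comp_whiskerRight, leftUnitor_whiskerRight]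
  rw [← leftUnitor_naturality, ← whisker_exchange_assoc, ComonObj.comul_assoc_assoc,
    ← associator_naturality_left_assoc]

theorem comul_rightHit (χ : H ⟶ 𝟙_ C) : Δ[H] ≫ rightHit χ ▷ H = Δ[H] ≫ H ◁ leftHit χ := by
  simp only [leftHit, rightHit, comp_whiskerRight, whiskerLeft_comp]
  rw [ComonObj.comul_assoc_assoc, ← associator_naturality_middle_assoc, triangle]

theorem leftHit_comp_leftHit (χ ψ : H ⟶ 𝟙_ C) :
    leftHit χ ≫ leftHit ψ = leftHit (Δ[H] ≫ (χ ⊗ₘ ψ) ≫ (λ_ (𝟙_ C)).hom) := by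
  conv_lhs => rw [leftHit.eq_1 ψ]
  rw [← Category.assoc, leftHit_comul, leftHit, leftHit]
  simp [MonoidalCategory.tensorHom_def, unitors_equal]

theorem leftHit_counit : leftHit ε[H] = 𝟙 H := by simp [leftHit]

end Comon

section Mon

variable {H : C} [MonObj H]

/-- Left multiplication `h ↦ s h`. -/
def leftMul (s : 𝟙_ C ⟶ H) : H ⟶ H := (λ_ H).inv ≫ s ▷ H ≫ μ[H]

/-- Right multiplication `h ↦ h s`. -/
def rightMul (s : 𝟙_ C ⟶ H) : H ⟶ H := (ρ_ H).inv ≫ H ◁ s ≫ μ[H]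

theorem mul_leftMul (s : 𝟙_ C ⟶ H) : μ[H] ≫ leftMul s = leftMul s ▷ H ≫ μ[H] := by
  simp only [leftMul, Category.assoc, comp_whiskerRight, MonObj.mul_assoc]
  rw [leftUnitor_inv_naturality_assoc, whisker_exchange_assoc]
  simp

theorem mul_rightMul (s : 𝟙_ C ⟶ H) : μ[H] ≫ rightMul s = H ◁ rightMul s ≫ μ[H] := by
  simp only [rightMul, Category.assoc, whiskerLeft_comp]
  rw [rightUnitor_inv_naturality_assoc, ← whisker_exchange_assoc, MonObj.mul_assoc]
  simp

theorem one_rightMul (s : 𝟙_ C ⟶ H) : η[H] ≫ rightMul s = s := by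
  rw [rightMul, rightUnitor_inv_naturality_assoc, ← whisker_exchange_assoc, MonObj.one_mul,
    leftUnitor_naturality, ← unitors_inv_equal, Iso.inv_hom_id_assoc]

end Mon

variable [BraidedCategory C]

section Bimon

variable {H : C} [BimonObj H]

theorem mul_leftHit (χ : H ⟶ 𝟙_ C) [IsMonHom χ] :
    μ[H] ≫ leftHit χ = (leftHit χ ⊗ₘ leftHit χ) ≫ μ[H] := by
  have h : μ[H] ≫ χ = (χ ⊗ₘ χ) ≫ (λ_ (𝟙_ C)).hom := IsMonHom.mul_hom χ
  have e : (leftHit χ ⊗ₘ leftHit χ) =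
      (Δ[H] ⊗ₘ Δ[H]) ≫ tensorμ H H H H ≫ ((χ ⊗ₘ χ) ⊗ₘ 𝟙 (H ⊗ H)) ≫
        ((λ_ (𝟙_ C)).hom ▷ (H ⊗ H)) ≫ (λ_ (H ⊗ H)).hom := by
    rw [leftHit, ← tensorHom_comp_tensorHom, ← tensorHom_comp_tensorHom, leftUnitor_monoidal,
      ← tensorHom_id, tensorμ_natural_assoc, id_tensorHom_id]
  rw [e, leftHit, BimonObj.mul_comul_assoc, ← tensorHom_id χ, tensorHom_comp_tensorHom_assoc, h]
  simp only [Category.assoc, ← leftUnitor_naturality, ← id_tensorHom, ← tensorHom_id,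
    tensorHom_comp_tensorHom_assoc, Category.id_comp, Category.comp_id]

theorem mul_rightHit (χ : H ⟶ 𝟙_ C) [IsMonHom χ] :
    μ[H] ≫ rightHit χ = (rightHit χ ⊗ₘ rightHit χ) ≫ μ[H] := by
  have h : μ[H] ≫ χ = (χ ⊗ₘ χ) ≫ (λ_ (𝟙_ C)).hom := IsMonHom.mul_hom χ
  have e : (rightHit χ ⊗ₘ rightHit χ) =
      (Δ[H] ⊗ₘ Δ[H]) ≫ tensorμ H H H H ≫ (𝟙 (H ⊗ H) ⊗ₘ (χ ⊗ₘ χ)) ≫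
        ((H ⊗ H) ◁ (λ_ (𝟙_ C)).hom) ≫ (ρ_ (H ⊗ H)).hom := by
    rw [rightHit, ← tensorHom_comp_tensorHom, ← tensorHom_comp_tensorHom, rightUnitor_monoidal,
      ← id_tensorHom, tensorμ_natural_assoc, id_tensorHom_id]
  rw [e, rightHit, BimonObj.mul_comul_assoc, ← id_tensorHom _ χ, tensorHom_comp_tensorHom_assoc, h]
  simp only [Category.assoc, ← rightUnitor_naturality, ← id_tensorHom, ← tensorHom_id,
    tensorHom_comp_tensorHom_assoc, Category.id_comp, Category.comp_id]

/-- A grouplike point on which `χ` takes the value `1` is fixed by `leftHit χ`. -/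
theorem comp_leftHit_of_grouplike {χ : H ⟶ 𝟙_ C} {s : 𝟙_ C ⟶ H}
    (hs : s ≫ Δ[H] = (λ_ (𝟙_ C)).inv ≫ (s ⊗ₘ s)) (h : s ≫ χ = 𝟙 _) : s ≫ leftHit χ = s := by
  rw [leftHit, reassoc_of% hs, ← tensorHom_id, tensorHom_comp_tensorHom_assoc, h, id_tensorHom,
    Category.comp_id, leftUnitor_naturality, Iso.inv_hom_id_assoc]

theorem rightMul_comp_leftHit {χ : H ⟶ 𝟙_ C} [IsMonHom χ] {s : 𝟙_ C ⟶ H}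
    (h : s ≫ leftHit χ = s) : rightMul s ≫ leftHit χ = leftHit χ ≫ rightMul s := by
  simp only [rightMul, Category.assoc, mul_leftHit]
  rw [rightUnitor_inv_naturality_assoc, ← id_tensorHom, tensorHom_comp_tensorHom_assoc, h,
    Category.id_comp, MonoidalCategory.tensorHom_def_assoc, id_tensorHom]

theorem leftMul_comul {s : 𝟙_ C ⟶ H} (hs : s ≫ Δ[H] = (λ_ (𝟙_ C)).inv ≫ (s ⊗ₘ s)) :
    leftMul s ≫ Δ[H] = Δ[H] ≫ (leftMul s ⊗ₘ leftMul s) := by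
  have e : (leftMul s ⊗ₘ leftMul s) = (λ_ (H ⊗ H)).inv ≫ ((λ_ (𝟙_ C)).inv ▷ (H ⊗ H)) ≫
      ((s ⊗ₘ s) ⊗ₘ 𝟙 (H ⊗ H)) ≫ tensorμ H H H H ≫ (μ[H] ⊗ₘ μ[H]) := by
    rw [leftMul, ← tensorHom_comp_tensorHom, ← tensorHom_comp_tensorHom, ← id_tensorHom_id,
      tensorμ_natural_assoc, tensorHom_id, Iso.eq_inv_comp, tensor_left_unitality]
    simp
  rw [e, leftMul]
  simp only [Category.assoc, BimonObj.mul_comul]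
  rw [leftUnitor_inv_naturality_assoc, ← tensorHom_id, tensorHom_comp_tensorHom_assoc, hs,
    ← id_tensorHom, ← tensorHom_id, tensorHom_comp_tensorHom_assoc,
    tensorHom_comp_tensorHom_assoc, Category.id_comp, Category.id_comp, Category.comp_id,
    Category.comp_id]

theorem leftMul_counit {s : 𝟙_ C ⟶ H} (hs : s ≫ ε[H] = 𝟙 _) : leftMul s ≫ ε[H] = ε[H] := by
  rw [leftMul, Category.assoc, Category.assoc, Bimon.mul_counit, ← tensorHom_id,
    tensorHom_comp_tensorHom_assoc, hs]
  simp

end Bimon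

/-! ### Twists and the antipode; adjoint and coadjoint formulas on `H` -/

section Hopf

variable {H : C} [HopfObj H]

/-- The antipode reverses comultiplication up to a braiding, which naturality removes because `χ`
lands in the unit object. -/
theorem rightHit_comp_antipode (χ : H ⟶ 𝟙_ C) :
    rightHit (𝒮[H] ≫ χ) ≫ 𝒮[H] = 𝒮[H] ≫ leftHit χ := by
  rw [leftHit, rightHit]
  rw [reassoc_of% HopfObj.antipode_comul H, ← BraidedCategory.braiding_naturality_assoc,
    ← BraidedCategory.braiding_naturality_right_assoc, braiding_leftUnitor]
  simp only [MonoidalCategory.tensorHom_def', Category.assoc, whiskerLeft_comp]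
  rw [← rightUnitor_naturality, whisker_exchange_assoc]

theorem leftMul_eq_braiding (s : 𝟙_ C ⟶ H) :
    leftMul s = (ρ_ H).inv ≫ H ◁ s ≫ (β_ H H).hom ≫ μ[H] := by
  rw [BraidedCategory.braiding_naturality_right_assoc, leftMul, rightUnitor_inv_braiding_assoc]

theorem rightMul_comp_antipode (s : 𝟙_ C ⟶ H) :
    rightMul s ≫ 𝒮[H] = 𝒮[H] ≫ leftMul (s ≫ 𝒮[H]) := by
  rw [leftMul_eq_braiding, rightMul]
  simp only [Category.assoc, HopfObj.mul_antipode]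
  rw [rightUnitor_inv_naturality_assoc, ← id_tensorHom, ← id_tensorHom, ← tensorHom_id,
    tensorHom_comp_tensorHom_assoc, tensorHom_comp_tensorHom_assoc]
  simp only [Category.id_comp, Category.comp_id]

theorem comp_antipode_grouplike {s : 𝟙_ C ⟶ H} (hs : s ≫ Δ[H] = (λ_ (𝟙_ C)).inv ≫ (s ⊗ₘ s)) :
    (s ≫ 𝒮[H]) ≫ Δ[H] = (λ_ (𝟙_ C)).inv ≫ (s ≫ 𝒮[H] ⊗ₘ s ≫ 𝒮[H]) := by
  rw [Category.assoc, HopfObj.antipode_comul, reassoc_of% hs,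
    BraidedCategory.braiding_naturality_assoc, tensorHom_comp_tensorHom, unitors_inv_equal,
    rightUnitor_inv_braiding_assoc, unitors_inv_equal]

theorem leftHit_antipode_comp_leftHit (χ : H ⟶ 𝟙_ C) [IsMonHom χ] :
    leftHit (𝒮[H] ≫ χ) ≫ leftHit χ = 𝟙 H := by
  rw [leftHit_comp_leftHit]
  have h : (χ ⊗ₘ χ) ≫ (λ_ (𝟙_ C)).hom = μ[H] ≫ χ := (IsMonHom.mul_hom χ).symm
  have h1 : η[H] ≫ χ = 𝟙 _ := IsMonHom.one_hom χ
  rw [show (𝒮[H] ≫ χ ⊗ₘ χ) = 𝒮[H] ▷ H ≫ (χ ⊗ₘ χ) by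
    rw [← tensorHom_id, tensorHom_comp_tensorHom, Category.id_comp], Category.assoc, h,
    HopfObj.antipode_left_assoc, h1, Category.comp_id, leftHit_counit]

/-- By coassociativity both twists fall on one leg, where `χ(S(h₁) h₂)` is the counit. -/
theorem comul_comp_rightHit_leftHit (χ : H ⟶ 𝟙_ C) [IsMonHom χ] :
    Δ[H] ≫ (rightHit (𝒮[H] ≫ χ) ⊗ₘ leftHit χ) = Δ[H] := by
  rw [MonoidalCategory.tensorHom_def, reassoc_of% comul_rightHit, ← whiskerLeft_comp,
    leftHit_antipode_comp_leftHit, whiskerLeft_id, Category.comp_id]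

theorem leftCoadSelf_comp (χ : H ⟶ 𝟙_ C) [IsMonHom χ] :
    leftCoadSelf H ≫ χ ▷ H ≫ (λ_ H).hom = leftHit χ ≫ rightHit (𝒮[H] ≫ χ) := by
  have h : μ[H] ≫ χ = (χ ⊗ₘ χ) ≫ (λ_ (𝟙_ C)).hom := IsMonHom.mul_hom χ
  have e : rightHit (𝒮[H] ≫ χ) = Δ[H] ≫ H ◁ 𝒮[H] ≫ (β_ H H).hom ≫ χ ▷ H ≫ (λ_ H).hom := by
    rw [← BraidedCategory.braiding_naturality_right_assoc, braiding_leftUnitor, rightHit,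
      whiskerLeft_comp_assoc]
  rw [leftHit, Category.assoc, Category.assoc, ← leftUnitor_naturality, ← whisker_exchange_assoc,
    e, leftCoadSelf]
  simp only [whiskerLeft_comp, Category.assoc]
  rw [← comp_whiskerRight_assoc, h, MonoidalCategory.tensorHom_def']
  simp

theorem rightAdSelf_comp (s : 𝟙_ C ⟶ H) (hs : s ≫ Δ[H] = (λ_ (𝟙_ C)).inv ≫ (s ⊗ₘ s)) :
    (ρ_ H).inv ≫ H ◁ s ≫ rightAdSelf H = leftMul (s ≫ 𝒮[H]) ≫ rightMul s := by
  have e : H ◁ s ≫ H ◁ Δ[H] = H ◁ (λ_ (𝟙_ C)).inv ≫ H ◁ (s ▷ 𝟙_ C) ≫ H ◁ (H ◁ s) := by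
    rw [← whiskerLeft_comp, hs, MonoidalCategory.tensorHom_def, whiskerLeft_comp, whiskerLeft_comp]
  rw [rightMul, rightUnitor_inv_naturality_assoc, leftMul_eq_braiding,
    rightAdSelf, reassoc_of% e]
  rw [← whiskerLeft_comp_assoc H (H ◁ s), whisker_exchange, whiskerLeft_comp_assoc,
    associator_inv_naturality_right_assoc, whisker_exchange_assoc, whisker_exchange_assoc,
    associator_inv_naturality_middle_assoc, associator_inv_naturality_middle_assoc,
    triangle_assoc_comp_left_inv_assoc]
  simp only [comp_whiskerRight, whiskerLeft_comp, Category.assoc]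

end Hopf

/-! ### Compatibility of the twists with tensor product and diagonal actions -/

theorem tensorLeftAction_intertwine {H M N : C} [ComonObj H] {r : H ⊗ M ⟶ M} {r' : H ⊗ N ⟶ N}
    {a b c : H ⟶ H} {f g : M ⟶ M} {f' g' : N ⟶ N} (hc : c ≫ Δ[H] = Δ[H] ≫ (a ⊗ₘ b))
    (h : (a ⊗ₘ f) ≫ r = r ≫ g) (h' : (b ⊗ₘ f') ≫ r' = r' ≫ g') :
    (c ⊗ₘ (f ⊗ₘ f')) ≫ tensorLeftAction r r' = tensorLeftAction r r' ≫ (g ⊗ₘ g') := by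
  have e : (c ⊗ₘ (f ⊗ₘ f')) ≫ Δ[H] ▷ (M ⊗ N) =
      Δ[H] ▷ (M ⊗ N) ≫ ((a ⊗ₘ b) ⊗ₘ (f ⊗ₘ f')) := by
    rw [← tensorHom_id, tensorHom_comp_tensorHom, hc, tensorHom_comp_tensorHom,
      Category.comp_id, Category.id_comp]
  rw [tensorLeftAction, reassoc_of% e, tensorμ_natural_assoc, tensorHom_comp_tensorHom, h, h',
    Category.assoc, Category.assoc, tensorHom_comp_tensorHom]

theorem tensorLeftCoaction_comp {H M N : C} [MonObj H] (c : M ⟶ H ⊗ M) (c' : N ⟶ H ⊗ N)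
    (χ : H ⟶ 𝟙_ C) [IsMonHom χ] :
    tensorLeftCoaction c c' ≫ χ ▷ (M ⊗ N) ≫ (λ_ (M ⊗ N)).hom =
      (c ≫ χ ▷ M ≫ (λ_ M).hom) ⊗ₘ (c' ≫ χ ▷ N ≫ (λ_ N).hom) := by
  have h : μ[H] ≫ χ = (χ ⊗ₘ χ) ≫ (λ_ (𝟙_ C)).hom := IsMonHom.mul_hom χ
  rw [← tensorHom_comp_tensorHom, ← tensorHom_comp_tensorHom, leftUnitor_monoidal,
    ← tensorHom_id χ M, ← tensorHom_id χ N, tensorμ_natural_assoc, id_tensorHom_id, tensorHom_id,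
    ← comp_whiskerRight_assoc, ← h, tensorLeftCoaction]
  simp only [Category.assoc, comp_whiskerRight]

theorem comp_tensorRightAction {H M N : C} [ComonObj H] (r : M ⊗ H ⟶ M) (r' : N ⊗ H ⟶ N)
    {s : 𝟙_ C ⟶ H} (hs : s ≫ Δ[H] = (λ_ (𝟙_ C)).inv ≫ (s ⊗ₘ s)) :
    (ρ_ (M ⊗ N)).inv ≫ (M ⊗ N) ◁ s ≫ tensorRightAction r r' =
      ((ρ_ M).inv ≫ M ◁ s ≫ r) ⊗ₘ ((ρ_ N).inv ≫ N ◁ s ≫ r') := by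
  have e : ((ρ_ M).inv ⊗ₘ (ρ_ N).inv) =
      (ρ_ (M ⊗ N)).inv ≫ (M ⊗ N) ◁ (λ_ (𝟙_ C)).inv ≫ tensorμ M N (𝟙_ C) (𝟙_ C) := by
    rw [Iso.eq_inv_comp, tensor_right_unitality]
    simp
  rw [← tensorHom_comp_tensorHom, ← tensorHom_comp_tensorHom, e, tensorRightAction]
  simp only [Category.assoc]
  rw [← id_tensorHom M s, ← id_tensorHom N s, ← tensorμ_natural_assoc, id_tensorHom_id,
    id_tensorHom, ← whiskerLeft_comp_assoc, ← whiskerLeft_comp_assoc, hs]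

section Bimon

variable {H : C} [BimonObj H]

theorem leftMul_leftDiag {s : 𝟙_ C ⟶ H} (hs : s ≫ Δ[H] = (λ_ (𝟙_ C)).inv ≫ (s ⊗ₘ s))
    (hs' : s ≫ ε[H] = 𝟙 _) (n : ℕ) :
    (leftMul s ⊗ₘ 𝟙 _) ≫ leftDiag H n = leftDiag H n ≫ tensorPowMap (leftMul s) n := by
  induction n with
  | zero =>
    change (leftMul s ⊗ₘ 𝟙 (𝟙_ C)) ≫ (ρ_ H).hom ≫ ε[H] = ((ρ_ H).hom ≫ ε[H]) ≫ 𝟙 (𝟙_ C)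
    rw [tensorHom_id, rightUnitor_naturality_assoc, leftMul_counit hs', Category.comp_id]
  | succ n ih =>
    change (leftMul s ⊗ₘ 𝟙 (H ⊗ tensorPow H n)) ≫ _ = _
    rw [← id_tensorHom_id]
    refine tensorLeftAction_intertwine (leftMul_comul hs) ?_ ih
    rw [tensorHom_id, mul_leftMul]

theorem rightMulAt_leftDiag (s : 𝟙_ C ⟶ H) (n i : ℕ) :
    H ◁ tensorPowAt (rightMul s) n i ≫ leftDiag H n =
      leftDiag H n ≫ tensorPowAt (rightMul s) n i := by
  induction n generalizing i with
  | zero => exact (whiskerLeft_id_assoc _ _ _).trans (Category.comp_id _).symm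
  | succ n ih =>
    have hc : 𝟙 H ≫ Δ[H] = Δ[H] ≫ (𝟙 H ⊗ₘ 𝟙 H) := by simp
    rw [← id_tensorHom]
    cases i with
    | zero =>
      change (𝟙 H ⊗ₘ rightMul s ▷ tensorPow H n) ≫ _ = _ ≫ rightMul s ▷ tensorPow H n
      rw [← tensorHom_id]
      refine tensorLeftAction_intertwine hc ?_ ?_
      · rw [id_tensorHom, mul_rightMul]
      · simp
    | succ i =>
      change (𝟙 H ⊗ₘ H ◁ tensorPowAt (rightMul s) n i) ≫ _ = _ ≫ H ◁ tensorPowAt (rightMul s) n i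
      rw [← id_tensorHom]
      refine tensorLeftAction_intertwine hc ?_ ?_
      · simp
      · rw [id_tensorHom, ih]

theorem leftHitAt_leftDiag (χ : H ⟶ 𝟙_ C) [IsMonHom χ] (n : ℕ) :
    (leftHit χ ⊗ₘ tensorPowAt (leftHit χ) (n + 1) 0) ≫ leftDiag H (n + 1) =
      leftDiag H (n + 1) ≫ tensorPowAt (leftHit χ) (n + 1) 0 := by
  change (leftHit χ ⊗ₘ leftHit χ ▷ tensorPow H n) ≫ _ = _ ≫ leftHit χ ▷ tensorPow H n
  rw [← tensorHom_id]
  refine tensorLeftAction_intertwine (a := leftHit χ) (b := 𝟙 H) ?_ (mul_leftHit χ).symm ?_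
  · rw [leftHit_comul, tensorHom_id]
  · simp

/-- Multiplicativity also puts the two twists on adjacent legs of the acting element, where `h`
absorbs them. -/
theorem straddle_leftDiag (χ ψ : H ⟶ 𝟙_ C) [IsMonHom χ] [IsMonHom ψ]
    (h : Δ[H] ≫ (rightHit ψ ⊗ₘ leftHit χ) = Δ[H]) (n i : ℕ) (hi : i + 1 < n) :
    H ◁ tensorPowStraddle (rightHit ψ) (leftHit χ) n (i + 1) ≫ leftDiag H n =
      leftDiag H n ≫ tensorPowStraddle (rightHit ψ) (leftHit χ) n (i + 1) := by
  induction n generalizing i with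
  | zero => omega
  | succ n ih =>
    cases i with
    | zero =>
      obtain ⟨n, rfl⟩ : ∃ m, n = m + 1 := ⟨n - 1, by omega⟩
      have e : tensorPowStraddle (rightHit ψ) (leftHit χ) (n + 1 + 1) (0 + 1) =
        (rightHit ψ ⊗ₘ tensorPowAt (leftHit χ) (n + 1) 0) :=
        (MonoidalCategory.tensorHom_def _ _).symm
      rw [← id_tensorHom, e]
      refine tensorLeftAction_intertwine (a := rightHit ψ) (b := leftHit χ) ?_
        (mul_rightHit ψ).symm (leftHitAt_leftDiag χ n)
      rw [h, Category.id_comp]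
    | succ i =>
      have e : tensorPowStraddle (rightHit ψ) (leftHit χ) (n + 1) (i + 1 + 1) =
        (𝟙 H ⊗ₘ tensorPowStraddle (rightHit ψ) (leftHit χ) n (i + 1)) := by
        rw [id_tensorHom]
        exact (whiskerLeft_comp _ _ _).symm
      rw [← id_tensorHom, e]
      refine tensorLeftAction_intertwine (a := 𝟙 H) (b := 𝟙 H) ?_ ?_ ?_
      · simp
      · simp
      · rw [id_tensorHom, ih i (by omega)]

end Bimon

/-! ### Moving twists past the trivial paracocyclic operator -/

section Hopf

variable {H : C} [HopfObj H]

theorem isMonHom_antipode_comp (χ : H ⟶ 𝟙_ C) [IsMonHom χ] : IsMonHom (𝒮[H] ≫ χ) where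
  one_hom := by
    have h1 : η[H] ≫ χ = 𝟙 _ := IsMonHom.one_hom χ
    rw [reassoc_of% HopfObj.one_antipode H, h1]
    rfl
  mul_hom := by
    have h : μ[H] ≫ χ = (χ ⊗ₘ χ) ≫ (λ_ (𝟙_ C)).hom := IsMonHom.mul_hom χ
    change _ = _ ≫ (λ_ (𝟙_ C)).hom
    rw [reassoc_of% HopfObj.mul_antipode H, h, ← BraidedCategory.braiding_naturality_assoc,
      tensorHom_comp_tensorHom_assoc, braiding_leftUnitor, unitors_equal]

theorem coadBy_eq (χ : H ⟶ 𝟙_ C) [IsMonHom χ] (n : ℕ) :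
    coadBy χ n = tensorPowMap (leftHit χ ≫ rightHit (𝒮[H] ≫ χ)) n := by
  induction n with
  | zero =>
    have h1 : η[H] ≫ χ = 𝟙 _ := IsMonHom.one_hom χ
    change (η[H] ≫ (ρ_ H).inv) ≫ χ ▷ 𝟙_ C ≫ (λ_ (𝟙_ C)).hom = 𝟙 (𝟙_ C)
    rw [unitors_equal, rightUnitor_naturality, Category.assoc, Iso.inv_hom_id_assoc, h1]
  | succ n ih =>
    refine (tensorLeftCoaction_comp (leftCoadSelf H) (leftCoad H n) χ).trans ?_
    rw [leftCoadSelf_comp]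
    exact congrArg (_ ⊗ₘ ·) ih

theorem adBy_eq {s : 𝟙_ C ⟶ H} (hs : s ≫ Δ[H] = (λ_ (𝟙_ C)).inv ≫ (s ⊗ₘ s))
    (hs' : s ≫ ε[H] = 𝟙 _) (n : ℕ) :
    adBy s n = tensorPowMap (leftMul (s ≫ 𝒮[H]) ≫ rightMul s) n := by
  induction n with
  | zero =>
    change (ρ_ (𝟙_ C)).inv ≫ 𝟙_ C ◁ s ≫ (λ_ H).hom ≫ ε[H] = 𝟙 (𝟙_ C)
    rw [leftUnitor_naturality_assoc, hs', ← unitors_inv_equal, Iso.inv_hom_id_assoc]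
  | succ n ih =>
    rw [adBy, rightAd, whisker_exchange_assoc, ← rightUnitor_inv_naturality_assoc,
      Iso.inv_comp_eq, reassoc_of% comp_tensorRightAction (rightAd H n) (rightAdSelf H) hs,
      rightAdSelf_comp s hs, ← tensorPowSnoc_naturality, ← ih, adBy]

/-- The paracocyclic operator of the trivial modular pair. -/
theorem paracocyclicOp_trivial (n : ℕ) :
    (paracocyclicOp ε[H] η[H] (n + 1)).asHom =
      (𝒮[H] ⊗ₘ tensorPowInsert η[H] n) ≫ leftDiag H (n + 1) := by
  have h : twistedAntipode ε[H] = 𝒮[H] := by simp [twistedAntipode, MonoidalCategory.tensorHom_def]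
  rw [← h]
  rfl

theorem paracocyclicOp_eq (χ : H ⟶ 𝟙_ C) (s : 𝟙_ C ⟶ H) (n : ℕ) :
    (paracocyclicOp χ s (n + 1)).asHom = tensorPowAt (leftHit χ) (n + 1) 0 ≫
      (paracocyclicOp ε[H] η[H] (n + 1)).asHom ≫ tensorPowAt (rightMul s) (n + 1) n := by
  have h : twistedAntipode χ = leftHit χ ≫ 𝒮[H] := by
    simp [twistedAntipode, leftHit, MonoidalCategory.tensorHom_def]
  rw [paracocyclicOp_trivial]
  change (twistedAntipode χ ⊗ₘ tensorPowInsert s n) ≫ leftDiag H (n + 1) =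
    leftHit χ ▷ tensorPow H n ≫ ((𝒮[H] ⊗ₘ tensorPowInsert η[H] n) ≫ leftDiag H (n + 1)) ≫
      tensorPowAt (rightMul s) (n + 1) n
  rw [Category.assoc, ← rightMulAt_leftDiag, h,
    ← tensorPowInsert_comp_at η[H] s (rightMul s) (one_rightMul s),
    ← id_tensorHom, ← tensorHom_id, tensorHom_comp_tensorHom_assoc,
    tensorHom_comp_tensorHom_assoc, Category.comp_id, Category.id_comp]

theorem paracocyclicOp_intertwine {n : ℕ} {a b : H ⟶ H} {p : tensorPow H n ⟶ tensorPow H n}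
    {q g : tensorPow H (n + 1) ⟶ tensorPow H (n + 1)} (ha : a ≫ 𝒮[H] = 𝒮[H] ≫ b)
    (hp : p ≫ tensorPowInsert η[H] n = tensorPowInsert η[H] n ≫ q)
    (hg : (b ⊗ₘ q) ≫ leftDiag H (n + 1) = leftDiag H (n + 1) ≫ g) :
    (a ⊗ₘ p) ≫ (paracocyclicOp ε[H] η[H] (n + 1)).asHom =
      (paracocyclicOp ε[H] η[H] (n + 1)).asHom ≫ g := by
  rw [paracocyclicOp_trivial]
  change (a ⊗ₘ p) ≫ (𝒮[H] ⊗ₘ tensorPowInsert η[H] n) ≫ leftDiag H (n + 1) =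
    ((𝒮[H] ⊗ₘ tensorPowInsert η[H] n) ≫ leftDiag H (n + 1)) ≫ g
  rw [Category.assoc, ← hg, tensorHom_comp_tensorHom_assoc, ha, hp, tensorHom_comp_tensorHom_assoc]

theorem straddle_comp_paracocyclicOp (χ : H ⟶ 𝟙_ C) [IsMonHom χ] (n i : ℕ) (hi : i < n + 1) :
    tensorPowStraddle (rightHit (𝒮[H] ≫ χ)) (leftHit χ) (n + 1) (i + 1) ≫
        (paracocyclicOp ε[H] η[H] (n + 1)).asHom =
      (paracocyclicOp ε[H] η[H] (n + 1)).asHom ≫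
        tensorPowStraddle (rightHit (𝒮[H] ≫ χ)) (leftHit χ) (n + 1) i := by
  have hη : η[H] ≫ leftHit χ = η[H] :=
    comp_leftHit_of_grouplike (Bimon.one_comul H) (IsMonHom.one_hom χ)
  have := isMonHom_antipode_comp χ
  cases i with
  | zero =>
    have e : tensorPowStraddle (rightHit (𝒮[H] ≫ χ)) (leftHit χ) (n + 1) (0 + 1) =
      (rightHit (𝒮[H] ≫ χ) ⊗ₘ tensorPowAt (leftHit χ) n 0) :=
      (MonoidalCategory.tensorHom_def _ _).symm
    rw [e]
    exact paracocyclicOp_intertwine (rightHit_comp_antipode χ)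
      (at_comp_tensorPowInsert_of_fixed _ _ hη n 0 (by omega)) (leftHitAt_leftDiag χ n)
  | succ i =>
    have e : tensorPowStraddle (rightHit (𝒮[H] ≫ χ)) (leftHit χ) (n + 1) (i + 1 + 1) =
        (𝟙 H ⊗ₘ tensorPowStraddle (rightHit (𝒮[H] ≫ χ)) (leftHit χ) n (i + 1)) := by
      rw [id_tensorHom]
      exact (whiskerLeft_comp _ _ _).symm
    -- When `i + 1 = n`, the second twist on the right-hand side acts on the inserted unit, which it
    -- fixes.
    have e' : tensorPowStraddle (rightHit (𝒮[H] ≫ χ)) (leftHit χ) n (i + 1) ≫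
        tensorPowInsert η[H] n = tensorPowInsert η[H] n ≫
        tensorPowStraddle (rightHit (𝒮[H] ≫ χ)) (leftHit χ) (n + 1) (i + 1) := by
      rw [tensorPowStraddle, tensorPowStraddle, Category.assoc,
        at_comp_tensorPowInsert_of_fixed _ _ hη n (i + 1) (by omega),
        ← Category.assoc, at_comp_tensorPowInsert _ _ n i (by omega), Category.assoc]
    rw [e]
    refine paracocyclicOp_intertwine ((Category.id_comp _).trans (Category.comp_id _).symm) e' ?_
    rw [id_tensorHom]
    exact straddle_leftDiag χ _ (comul_comp_rightHit_leftHit χ) (n + 1) i (by omega)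

/-- Right multiplication by `s` on the tensorand of index `i - 1`, and left multiplication by the
antipode of `s` on all tensorands for `i = 0`. -/
def shiftedMul (s : 𝟙_ C ⟶ H) (n : ℕ) : ℕ → (tensorPow H n ⟶ tensorPow H n)
  | 0 => tensorPowMap (leftMul (s ≫ 𝒮[H])) n
  | i + 1 => tensorPowAt (rightMul s) n i

theorem shiftedMul_comp_paracocyclicOp {s : 𝟙_ C ⟶ H}
    (hs : s ≫ Δ[H] = (λ_ (𝟙_ C)).inv ≫ (s ⊗ₘ s)) (hs' : s ≫ ε[H] = 𝟙 _) (n i : ℕ)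
    (hi : i < n + 1) :
    shiftedMul s (n + 1) (i + 1) ≫ (paracocyclicOp ε[H] η[H] (n + 1)).asHom =
      (paracocyclicOp ε[H] η[H] (n + 1)).asHom ≫ shiftedMul s (n + 1) i := by
  cases i with
  | zero =>
    have e : shiftedMul s (n + 1) (0 + 1) = (rightMul s ⊗ₘ 𝟙 (tensorPow H n)) :=
      (tensorHom_id _ _).symm
    rw [e]
    exact paracocyclicOp_intertwine (rightMul_comp_antipode s)
      ((Category.id_comp _).trans (Category.comp_id _).symm)
      (leftMul_leftDiag (comp_antipode_grouplike hs)
        (by rw [Category.assoc, HopfObj.antipode_counit, hs']) (n + 1))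
  | succ i =>
    have e : shiftedMul s (n + 1) (i + 1 + 1) = (𝟙 H ⊗ₘ tensorPowAt (rightMul s) n i) :=
      (id_tensorHom _ _).symm
    rw [e]
    refine paracocyclicOp_intertwine ((Category.id_comp _).trans (Category.comp_id _).symm)
      (at_comp_tensorPowInsert _ _ n i (by omega)) ?_
    rw [id_tensorHom]
    exact rightMulAt_leftDiag s (n + 1) i

theorem descProd_shiftedMul (s : 𝟙_ C ⟶ H) (n : ℕ) :
    descProd (M := End (tensorPow H n)) (fun i => shiftedMul s n i) (n + 1) =
      tensorPowMap (leftMul (s ≫ 𝒮[H]) ≫ rightMul s) n := by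
  rw [descProd_succ', tensorPowMap_comp]
  exact congrArg (tensorPowMap (leftMul (s ≫ 𝒮[H])) n ≫ ·) (descProd_tensorPowAt (rightMul s) n)

theorem paracocyclicOp_pow (χ : H ⟶ 𝟙_ C) [IsMonHom χ] {s : 𝟙_ C ⟶ H}
    (hs : s ≫ Δ[H] = (λ_ (𝟙_ C)).inv ≫ (s ⊗ₘ s)) (hs' : s ≫ ε[H] = 𝟙 _) (h : s ≫ χ = 𝟙 _)
    (n : ℕ) :
    (paracocyclicOp χ s (n + 1) ^ (n + 1 + 1)).asHom =
      tensorPowMap (leftHit χ ≫ rightHit (𝒮[H] ≫ χ)) (n + 1) ≫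
        (paracocyclicOp ε[H] η[H] (n + 1) ^ (n + 1 + 1)).asHom ≫
          tensorPowMap (leftMul (s ≫ 𝒮[H]) ≫ rightMul s) (n + 1) := by
  -- In `End`, `x * y` means `y ≫ x`.
  let t : End (tensorPow H (n + 1)) := paracocyclicOp ε[H] η[H] (n + 1)
  let d : ℕ → End (tensorPow H (n + 1)) := fun i =>
    tensorPowStraddle (rightHit (𝒮[H] ≫ χ)) (leftHit χ) (n + 1) i
  let g : ℕ → End (tensorPow H (n + 1)) := fun i => shiftedMul s (n + 1) i
  have hd : ∀ i < n + 1, d i * t = t * d (i + 1) := fun i hi =>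
    (straddle_comp_paracocyclicOp χ n i hi).symm
  have hg : ∀ i < n + 1, t * g (i + 1) = g i * t := fun i hi =>
    shiftedMul_comp_paracocyclicOp hs hs' n i hi
  -- On the first tensorand the two twists commute because `χ(s) = 1`; this lets the `g` chain pass
  -- `t * d 0`, not only `t`.
  have hdg : ∀ i, d 0 * g (i + 1) = g (i + 1) * d 0 := fun i =>
    tensorPowAt_comm (rightMul_comp_leftHit (comp_leftHit_of_grouplike hs h)) (n + 1) i 0
  have htd : ∀ i < n + 1, (t * d 0) * g (i + 1) = g i * (t * d 0) := fun i hi => by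
    rw [mul_assoc, hdg, ← mul_assoc, hg i hi, mul_assoc]
  have e : paracocyclicOp χ s (n + 1) = g (n + 1) * (t * d 0) :=
    (paracocyclicOp_eq χ s n).trans (Category.assoc _ _ _).symm
  rw [e, mul_pow_of_intertwine_left htd, mul_pow_of_intertwine_right hd _ le_rfl,
    descProd_shiftedMul, descProd_tensorPowStraddle]
  exact Category.assoc _ _ _

end Hopf

end BraidedConnesMoscovici

theorem corollary4p2 {C : Type*} [Category* C] [MonoidalCategory C] [BraidedCategory C]
    (H : C) [HopfObj H] [IsIso 𝒮[H]] (δ : H ⟶ 𝟙_ C) (σ : 𝟙_ C ⟶ H)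
    (h : BraidedConnesMoscovici.IsModularPair δ σ) (n : ℕ) :
    (BraidedConnesMoscovici.paracocyclicOp δ σ n ^ (n + 1)).asHom =
      BraidedConnesMoscovici.coadBy δ n ≫
        (BraidedConnesMoscovici.paracocyclicOp ε[H] η[H] n ^ (n + 1)).asHom ≫
          BraidedConnesMoscovici.adBy σ n := by
  have := h.isMonHom
  have hs : σ ≫ Δ[H] = (λ_ (𝟙_ C)).inv ≫ (σ ⊗ₘ σ) := h.isComonHom.hom_comul
  have hs' : σ ≫ ε[H] = 𝟙 _ := h.isComonHom.hom_counit
  rw [BraidedConnesMoscovici.coadBy_eq, BraidedConnesMoscovici.adBy_eq hs hs']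
  cases n with
  | zero =>
    exact ((Category.id_comp _).trans (Category.comp_id _)).symm
  | succ n =>
    exact BraidedConnesMoscovici.paracocyclicOp_pow δ hs hs' h.comp_eq n
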